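/- Let $\mathbb D$ be the open unit disc. Let $\tau\in\overline{\mathbb D}$, let $p:\mathbb D\to\mathbb C$ be holomorphic and zero-free with $\operatorname{Re}p\ge 0$, and let $$G(z)=(z-\tau)(\overline{\tau}z-1)p(z),\qquad z\in\mathbb D,$$ be the infinitesimal generator of a semigroup of holomorphic self-maps of $\mathbb D$ with Berkson--Porta data $(\tau,p)$. Let $\mu$ be a positive finite Borel measure on $\partial\mathbb D$ such that $$\frac1{p(z)}=\frac1{2\pi}\int_0^{2\pi}\frac{e^{it}+z}{e^{it}-z}\,d\mu(t)\qquad\text{for all }z\in\mathbb D$$ (so, in particular, $p(0)$ is real). A point $x\in\partial\mathbb D$ is called a regular pole of $G$ if $$\angle\liminf_{z\to x}|G(z)(x-z)|=C\quad\text{for some } C\in(0,+\infty),$$ where $\angle\liminf$ is the lower limit under non-tangential approach, that is, the infimum over all $M>1$ of the lower limits as $z\to x$ within $\{z\in\mathbb D:|x-z|<M(1-|z|)\}$. Let $x=e^{i\theta}$, $\theta\in\mathbb R$, with $x\ne\tau$. Then $x$ is a regular pole of $G$ if and only if both of the following hold: 1. the limit $\displaystyle\lim_{(0,1)\ni r\to1}\int_0^{2\pi}\frac{d\mu(t)}{|e^{it}-re^{i\theta}|^2}$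 exists and is finite; 2. $\displaystyle\lim_{(0,1)\ni r\to1}\int_0^{2\pi}\frac{\sin(t-\theta)}{|e^{it}-re^{i\theta}|^2}\,\frac{d\mu(t)}{1-r}=0.$ -/

import Mathlib

open Filter Topology MeasureTheory

/-- The Stolz region of aperture `M` at the boundary point `x` of the unit disc. -/
def stolzRegion (x : ℂ) (M : ℝ) : Set ℂ :=
  {z : ℂ | ‖z‖ < 1 ∧ ‖x - z‖ < M * (1 - ‖z‖)}

/-- The filter of non-tangential approach to `x` from within the unit disc: a property holds
eventually along it iff, for every aperture `M > 1`, it holds in the Stolz region of aperture `M`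
at all points close enough to `x`. Limits and lower limits along this filter are the angular
limits and the angular lower limits at `x`. -/
noncomputable def angularFilter (x : ℂ) : Filter ℂ :=
  ⨆ (M : ℝ) (_ : 1 < M), 𝓝[stolzRegion x M] x

/-- The point `x` of the unit circle is a regular pole of `G` of mass `C > 0`: the angular lower
limit of `|G(z) (x - z)|` as `z → x`, taken in `[0, ∞]`, is equal to `C`. -/
def IsRegularPoleOfMass (G : ℂ → ℂ) (C : ℝ) (x : ℂ) : Prop :=
  ‖x‖ = 1 ∧ 0 < C ∧
    liminf (fun z : ℂ => ENNReal.ofReal ‖G z * (x - z)‖) (angularFilter x) = ENNReal.ofReal C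

/-- The set of regular poles of `G`, of any positive mass. -/
def regularPoles (G : ℂ → ℂ) : Set ℂ :=
  {x : ℂ | ∃ C : ℝ, IsRegularPoleOfMass G C x}

/-! Write H for the Herglotz integral of μ, so that 1/p = H/(2π). Both sides of the equivalence
amount to H(rx) = O(1 - r). Since x ≠ τ, the factor (z - τ)(τ̄z - 1) does not vanish at x, so
|G(z)(x - z)| behaves like a positive constant over |H(z)/(x - z)|; a positive lower limit bounds H
along the radius. The real and imaginary parts of H(rx)/(1 - r) are 1 + r and -2r times the two
radial integrals, so their convergence gives the bound. The bound in turn improves itself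
(`herglotzIntegral_tendsto_of_radial_bound`): Fatou makes |ζ - x|⁻² integrable, and dominated
convergence in Stolz regions gives H(z)/(x - z) the angular limit 2x̄L, L = ∫|ζ - x|⁻² dμ. Reality
of L kills the imaginary part, and L > 0 makes the pole regular. -/

open ComplexConjugate

/-- The Herglotz transform of a measure on the unit circle, up to the factor `1 / (2 * π)`. -/
noncomputable def herglotzIntegral (μ : Measure (Metric.sphere (0 : ℂ) 1)) (z : ℂ) : ℂ :=
  ∫ ζ : Metric.sphere (0 : ℂ) 1, ((ζ : ℂ) + z) / ((ζ : ℂ) - z) ∂μ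

/-! ### Circle and Stolz-region estimates -/

theorem norm_coe_unitSphere (ζ : Metric.sphere (0 : ℂ) 1) : ‖(ζ : ℂ)‖ = 1 := by
  simp

theorem unitSphere_sub_ne_zero (ζ : Metric.sphere (0 : ℂ) 1) {z : ℂ} (hz : ‖z‖ < 1) :
    (ζ : ℂ) - z ≠ 0 := by
  intro h
  rw [← sub_eq_zero.1 h, norm_coe_unitSphere] at hz
  exact lt_irrefl _ hz

theorem Continuous.integrable_unitSphere {E : Type*} [NormedAddCommGroup E]
    (μ : Measure (Metric.sphere (0 : ℂ) 1)) [IsFiniteMeasure μ]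
    {f : Metric.sphere (0 : ℂ) 1 → E} (hf : Continuous f) : Integrable f μ :=
  hf.integrable_of_hasCompactSupport (HasCompactSupport.of_compactSpace f)

theorem norm_real_mul_unit {x : ℂ} (hx : ‖x‖ = 1) {r : ℝ} (hr : r ∈ Set.Ioo (0 : ℝ) 1) :
    ‖(r : ℂ) * x‖ = r := by
  rw [norm_mul, hx, mul_one, Complex.norm_real, Real.norm_of_nonneg hr.1.le]

theorem norm_sub_real_mul_unit {x : ℂ} (hx : ‖x‖ = 1) {r : ℝ} (hr : r ∈ Set.Ioo (0 : ℝ) 1) :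
    ‖x - (r : ℂ) * x‖ = 1 - r := by
  have : x - (r : ℂ) * x = ((1 - r : ℝ) : ℂ) * x := by push_cast; ring
  rw [this, norm_mul, hx, mul_one, Complex.norm_real, Real.norm_of_nonneg (by linarith [hr.2])]

theorem Ioo_zero_one_mem_nhdsLT_one : Set.Ioo (0 : ℝ) 1 ∈ 𝓝[<] (1 : ℝ) :=
  Ioo_mem_nhdsLT one_pos

theorem tendsto_radial_angularFilter {x : ℂ} (hx : ‖x‖ = 1) :
    Tendsto (fun r : ℝ => (r : ℂ) * x) (𝓝[<] 1) (angularFilter x) := by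
  have h : Tendsto (fun r : ℝ => (r : ℂ) * x) (𝓝[<] 1) (𝓝[stolzRegion x 2] x) := by
    refine tendsto_nhdsWithin_iff.2 ⟨?_, ?_⟩
    · have : Continuous fun r : ℝ => (r : ℂ) * x := by fun_prop
      simpa using (this.tendsto 1).mono_left nhdsWithin_le_nhds
    · filter_upwards [Ioo_zero_one_mem_nhdsLT_one] with r hr
      refine ⟨by rw [norm_real_mul_unit hx hr]; exact hr.2, ?_⟩
      rw [norm_sub_real_mul_unit hx hr, norm_real_mul_unit hx hr]
      linarith [hr.2]
  exact h.mono_right (le_iSup₂_of_le 2 one_lt_two le_rfl)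

theorem angularFilter_neBot {x : ℂ} (hx : ‖x‖ = 1) : (angularFilter x).NeBot :=
  (tendsto_radial_angularFilter hx).neBot

theorem angularFilter_le_nhds (x : ℂ) : angularFilter x ≤ 𝓝 x :=
  iSup₂_le fun _ _ => nhdsWithin_le_nhds

theorem eventually_norm_lt_one_angularFilter (x : ℂ) : ∀ᶠ z in angularFilter x, ‖z‖ < 1 := by
  simp only [angularFilter, eventually_iSup]
  intro M _
  filter_upwards [self_mem_nhdsWithin] with z hz using hz.1

/-- Supplies a dominating function independent of z; it rests on 1 - |z| ≤ |ζ - z|. -/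
theorem norm_unitSphere_sub_le_of_mem_stolzRegion {x z : ℂ} {M : ℝ} (hM : 1 < M)
    (hz : z ∈ stolzRegion x M) (ζ : Metric.sphere (0 : ℂ) 1) :
    ‖(ζ : ℂ) - x‖ ≤ (1 + M) * ‖(ζ : ℂ) - z‖ := by
  have h1 : ‖(ζ : ℂ) - x‖ ≤ ‖(ζ : ℂ) - z‖ + ‖x - z‖ := by
    rw [norm_sub_rev x z]
    exact norm_sub_le_norm_sub_add_norm_sub _ _ _
  have h2 : 1 - ‖z‖ ≤ ‖(ζ : ℂ) - z‖ := by
    have := norm_sub_norm_le (ζ : ℂ) z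
    rwa [norm_coe_unitSphere] at this
  nlinarith [hz.2]

/-- Conjugation is inversion on the circle. The phase does not depend on ζ, which is why the second
radial integral must tend to 0. -/
theorem div_sub_sq_eq_of_norm_eq_one {ζ x : ℂ} (hζ : ‖ζ‖ = 1) (hx : ‖x‖ = 1) (h : ζ ≠ x) :
    ζ / (ζ - x) ^ 2 = -conj x * ((1 / ‖ζ - x‖ ^ 2 : ℝ) : ℂ) := by
  have hx0 : x ≠ 0 := by rintro rfl; simp at hx
  have hζ0 : ζ ≠ 0 := by rintro rfl; simp at hζ
  have hs : ζ - x ≠ 0 := sub_ne_zero.2 h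
  have hn : ((‖ζ - x‖ : ℂ)) ^ 2 = (ζ - x) * (ζ⁻¹ - x⁻¹) := by
    rw [← Complex.mul_conj', map_sub, Complex.inv_eq_conj hζ, Complex.inv_eq_conj hx]
  have hs' : x - ζ ≠ 0 := sub_ne_zero.2 h.symm
  have hn' : ((‖ζ - x‖ : ℂ)) ^ 2 = -(ζ - x) ^ 2 / (ζ * x) := by
    rw [hn]; field_simp; ring
  push_cast
  rw [hn', ← Complex.inv_eq_conj hx]
  field_simp

/-! ### The Herglotz transform along a radius -/

theorem herglotzKernel_radial_eq {ζ x : ℂ} (hζ : ‖ζ‖ = 1) {θ : ℝ}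
    (hx : x = Complex.exp (θ * Complex.I)) {r : ℝ} (hr : r ∈ Set.Ioo (0 : ℝ) 1) :
    (ζ + r * x) / (ζ - r * x) / ((1 - r : ℝ) : ℂ) =
      (((1 + r) * (1 / ‖ζ - r * x‖ ^ 2) : ℝ) : ℂ) +
      ((-(2 * r) * (Real.sin (Complex.arg ζ - θ) / ‖ζ - r * x‖ ^ 2 * (1 / (1 - r))) : ℝ) : ℂ) *
        Complex.I := by
  have hx1 : ‖x‖ = 1 := by rw [hx, Complex.norm_exp_ofReal_mul_I]
  have hne : ζ - r * x ≠ 0 := by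
    intro h
    have := norm_real_mul_unit hx1 hr
    rw [← sub_eq_zero.1 h, hζ] at this
    exact hr.2.ne this.symm
  have hsq : ((‖ζ - r * x‖ : ℂ)) ^ 2 = (ζ - r * x) * conj (ζ - r * x) :=
    (Complex.mul_conj' _).symm
  have hcne : conj (ζ - r * x) ≠ 0 := (map_ne_zero _).2 hne
  have hr1 : (1 : ℂ) - r ≠ 0 := by
    rw [← Complex.ofReal_one, ← Complex.ofReal_sub, Complex.ofReal_ne_zero]
    linarith [hr.2]
  have hζe : ζ = Complex.exp (Complex.arg ζ * Complex.I) := by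
    conv_lhs => rw [← Complex.norm_mul_exp_arg_mul_I ζ, hζ]
    simp
  have hζc : ζ * conj ζ = 1 := by rw [Complex.mul_conj', hζ]; simp
  have hxc : x * conj x = 1 := by rw [Complex.mul_conj', hx1]; simp
  have hsin : 2 * (Real.sin (Complex.arg ζ - θ) : ℂ) * Complex.I = ζ * conj x - conj ζ * x := by
    have e1 : ζ * conj x = Complex.exp ((Complex.arg ζ - θ : ℝ) * Complex.I) := by
      conv_lhs => rw [hζe, hx]
      rw [← Complex.exp_conj, ← Complex.exp_add]
      congr 1
      simp
      ring
    have e2 : conj ζ * x = conj (ζ * conj x) := by simp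
    rw [e2, Complex.sub_conj, e1, Complex.exp_ofReal_mul_I_im]
    push_cast
    ring
  push_cast
  have hsin' := hsin
  push_cast at hsin'
  rw [hsq]
  have hnum : (ζ + r * x) * conj (ζ - r * x) =
      (1 - (r : ℂ)) * (1 + r) - r * (ζ * conj x - conj ζ * x) := by
    simp only [map_sub, map_mul, Complex.conj_ofReal]
    linear_combination hζc - (r : ℂ) ^ 2 * hxc
  rw [← hsin'] at hnum
  field_simp
  linear_combination hnum

theorem herglotzIntegral_radial_eq (μ : Measure (Metric.sphere (0 : ℂ) 1)) [IsFiniteMeasure μ]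
    {θ : ℝ} {x : ℂ} (hx : x = Complex.exp (θ * Complex.I)) {r : ℝ}
    (hr : r ∈ Set.Ioo (0 : ℝ) 1) :
    herglotzIntegral μ (r * x) / ((1 - r : ℝ) : ℂ) =
      (((1 + r) * ∫ ζ : Metric.sphere (0 : ℂ) 1, 1 / ‖(ζ : ℂ) - r * x‖ ^ 2 ∂μ : ℝ) : ℂ) +
      ((-(2 * r) * ∫ ζ : Metric.sphere (0 : ℂ) 1, Real.sin (Complex.arg (ζ : ℂ) - θ) /
        ‖(ζ : ℂ) - r * x‖ ^ 2 * (1 / (1 - r)) ∂μ : ℝ) : ℂ) * Complex.I := by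
  have hx1 : ‖x‖ = 1 := by rw [hx, Complex.norm_exp_ofReal_mul_I]
  have hrx : ‖(r : ℂ) * x‖ < 1 := by rw [norm_real_mul_unit hx1 hr]; exact hr.2
  have hint : Integrable (fun ζ : Metric.sphere (0 : ℂ) 1 =>
      ((ζ : ℂ) + r * x) / ((ζ : ℂ) - r * x) / ((1 - r : ℝ) : ℂ)) μ := by
    apply Continuous.integrable_unitSphere
    exact ((continuous_subtype_val.add continuous_const).div
      (continuous_subtype_val.sub continuous_const)
        fun ζ => unitSphere_sub_ne_zero ζ hrx).div_const _
  have hre := integral_re hint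
  have him := integral_im hint
  have hk := fun ζ : Metric.sphere (0 : ℂ) 1 =>
    herglotzKernel_radial_eq (norm_coe_unitSphere ζ) hx hr
  rw [herglotzIntegral, ← integral_div, ← Complex.re_add_im (∫ _, _ ∂μ)]
  congr 2
  · refine Eq.trans hre.symm ?_
    rw [← integral_const_mul]
    refine integral_congr_ae (Eventually.of_forall fun ζ => ?_)
    simp only [hk]
    rw [RCLike.re_eq_complex_re, Complex.add_re, Complex.ofReal_re, Complex.re_ofReal_mul]
    simp
  · refine congrArg _ (Eq.trans him.symm ?_)
    rw [← integral_const_mul]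
    refine integral_congr_ae (Eventually.of_forall fun ζ => ?_)
    simp only [hk]
    rw [RCLike.im_eq_complex_im, Complex.add_im, Complex.ofReal_im, Complex.im_ofReal_mul]
    simp

/-! ### From the radial bound to the angular limit -/

/-- Fatou's lemma as r → 1. It is run in `ENNReal`, where the limit integrand is ∞ at ζ = x, so
finiteness excludes an atom there; the real convention 1/0 = 0 would hide it. -/
theorem ae_ne_and_integrable_of_radial_bound (μ : Measure (Metric.sphere (0 : ℂ) 1))
    [IsFiniteMeasure μ] {x : ℂ} (hx : ‖x‖ = 1) {K : ℝ}
    (hK : ∀ᶠ r : ℝ in 𝓝[<] 1,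
      ∫ ζ : Metric.sphere (0 : ℂ) 1, 1 / ‖(ζ : ℂ) - r * x‖ ^ 2 ∂μ ≤ K) :
    (∀ᵐ ζ : Metric.sphere (0 : ℂ) 1 ∂μ, (ζ : ℂ) ≠ x) ∧
      Integrable (fun ζ : Metric.sphere (0 : ℂ) 1 => 1 / ‖(ζ : ℂ) - x‖ ^ 2) μ := by
  have hmeas : ∀ w : ℂ, Measurable fun ζ : Metric.sphere (0 : ℂ) 1 => (‖(ζ : ℂ) - w‖ₑ ^ 2)⁻¹ := by
    intro w
    fun_prop
  have hlim : ∀ ζ : Metric.sphere (0 : ℂ) 1,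
      liminf (fun r : ℝ => (‖(ζ : ℂ) - r * x‖ₑ ^ 2)⁻¹) (𝓝[<] 1) = (‖(ζ : ℂ) - x‖ₑ ^ 2)⁻¹ := by
    intro ζ
    apply Tendsto.liminf_eq
    have hc : Continuous fun r : ℝ => (‖(ζ : ℂ) - r * x‖ₑ ^ 2)⁻¹ := by
      fun_prop
    simpa using (hc.tendsto 1).mono_left nhdsWithin_le_nhds
  have hfin : ∫⁻ ζ : Metric.sphere (0 : ℂ) 1, (‖(ζ : ℂ) - x‖ₑ ^ 2)⁻¹ ∂μ ≤ ENNReal.ofReal K := by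
    have hF := lintegral_liminf_le (μ := μ) (u := 𝓝[<] (1 : ℝ))
      (f := fun (r : ℝ) (ζ : Metric.sphere (0 : ℂ) 1) => (‖(ζ : ℂ) - r * x‖ₑ ^ 2)⁻¹)
      fun r => hmeas _
    simp only [hlim] at hF
    refine hF.trans (liminf_le_of_frequently_le' (Eventually.frequently ?_))
    filter_upwards [hK, Ioo_zero_one_mem_nhdsLT_one] with r hrK hr
    have hrx : ‖(r : ℂ) * x‖ < 1 := by rw [norm_real_mul_unit hx hr]; exact hr.2
    have hint : Integrable (fun ζ : Metric.sphere (0 : ℂ) 1 => 1 / ‖(ζ : ℂ) - r * x‖ ^ 2) μ := by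
      apply Continuous.integrable_unitSphere
      exact continuous_const.div (by fun_prop) fun ζ =>
        pow_ne_zero 2 (norm_ne_zero_iff.2 (unitSphere_sub_ne_zero ζ hrx))
    refine le_trans (le_of_eq ?_) (ENNReal.ofReal_le_ofReal hrK)
    rw [ofReal_integral_eq_lintegral_ofReal hint (Eventually.of_forall fun ζ => by positivity)]
    refine lintegral_congr fun ζ => ?_
    have hpos : 0 < ‖(ζ : ℂ) - r * x‖ := norm_pos_iff.2 (unitSphere_sub_ne_zero ζ hrx)
    rw [one_div, ENNReal.ofReal_inv_of_pos (by positivity), ENNReal.ofReal_pow hpos.le,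
      ofReal_norm]
  have hlt := ae_lt_top (hmeas x) (ne_top_of_le_ne_top ENNReal.ofReal_ne_top hfin)
  have hae : ∀ᵐ ζ : Metric.sphere (0 : ℂ) 1 ∂μ, (ζ : ℂ) ≠ x := by
    filter_upwards [hlt] with ζ hζ h
    simp [h] at hζ
  refine ⟨hae, ?_, ?_⟩
  · exact Measurable.aestronglyMeasurable (by fun_prop)
  · refine lt_of_le_of_lt (le_trans (le_of_eq (lintegral_congr_ae ?_)) hfin) ENNReal.ofReal_lt_top
    filter_upwards [hae] with ζ hζ
    have hpos : 0 < ‖(ζ : ℂ) - x‖ := norm_pos_iff.2 (sub_ne_zero.2 hζ)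
    rw [Real.enorm_of_nonneg (by positivity), one_div, ENNReal.ofReal_inv_of_pos (by positivity),
      ENNReal.ofReal_pow hpos.le, ofReal_norm]

theorem tendsto_integral_differenceQuotient (μ : Measure (Metric.sphere (0 : ℂ) 1))
    {x : ℂ} (hx : ‖x‖ = 1)
    (hne : ∀ᵐ ζ : Metric.sphere (0 : ℂ) 1 ∂μ, (ζ : ℂ) ≠ x)
    (hint : Integrable (fun ζ : Metric.sphere (0 : ℂ) 1 => 1 / ‖(ζ : ℂ) - x‖ ^ 2) μ) :
    Tendsto (fun z : ℂ => ∫ ζ : Metric.sphere (0 : ℂ) 1, (ζ : ℂ) / (((ζ : ℂ) - z) * (ζ - x)) ∂μ)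
      (angularFilter x)
      (𝓝 (-conj x * ((∫ ζ : Metric.sphere (0 : ℂ) 1, 1 / ‖(ζ : ℂ) - x‖ ^ 2 ∂μ : ℝ) : ℂ))) := by
  have hval : ∫ ζ : Metric.sphere (0 : ℂ) 1, (ζ : ℂ) / (ζ - x) ^ 2 ∂μ =
      -conj x * ((∫ ζ : Metric.sphere (0 : ℂ) 1, 1 / ‖(ζ : ℂ) - x‖ ^ 2 ∂μ : ℝ) : ℂ) := by
    rw [← integral_complex_ofReal, ← integral_const_mul]
    refine integral_congr_ae ?_
    filter_upwards [hne] with ζ hζ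
    exact div_sub_sq_eq_of_norm_eq_one (norm_coe_unitSphere ζ) hx hζ
  rw [← hval]
  refine tendsto_iSup.2 fun M => tendsto_iSup.2 fun hM => ?_
  refine tendsto_integral_filter_of_dominated_convergence
    (fun ζ : Metric.sphere (0 : ℂ) 1 => (1 + M) * (1 / ‖(ζ : ℂ) - x‖ ^ 2)) ?_ ?_
    (hint.const_mul _) ?_
  · exact Eventually.of_forall fun z => Measurable.aestronglyMeasurable (by fun_prop)
  · filter_upwards [self_mem_nhdsWithin] with z hz
    filter_upwards [hne] with ζ hζ
    have hpos : 0 < ‖(ζ : ℂ) - x‖ := norm_pos_iff.2 (sub_ne_zero.2 hζ)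
    have hpos' : 0 < ‖(ζ : ℂ) - z‖ := norm_pos_iff.2 (unitSphere_sub_ne_zero ζ hz.1)
    have hle := norm_unitSphere_sub_le_of_mem_stolzRegion hM hz ζ
    rw [norm_div, norm_mul, norm_coe_unitSphere, mul_one_div, div_le_div_iff₀ (by positivity)
      (by positivity)]
    nlinarith [mul_le_mul_of_nonneg_right hle hpos.le]
  · filter_upwards [hne] with ζ hζ
    have hs : (ζ : ℂ) - x ≠ 0 := sub_ne_zero.2 hζ
    have hc : ContinuousAt (fun z : ℂ => (ζ : ℂ) / (((ζ : ℂ) - z) * (ζ - x))) x :=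
      continuousAt_const.div (by fun_prop) (mul_ne_zero hs hs)
    have := hc.tendsto.mono_left (nhdsWithin_le_nhds (s := stolzRegion x M))
    rwa [← pow_two] at this

/-- Integrates the difference of the kernels at z and x; the kernel at x is integrable because |ζ -
x|⁻¹ ≤ 1 + |ζ - x|⁻². -/
theorem herglotzIntegral_eq_add (μ : Measure (Metric.sphere (0 : ℂ) 1)) [IsFiniteMeasure μ]
    {x : ℂ}
    (hne : ∀ᵐ ζ : Metric.sphere (0 : ℂ) 1 ∂μ, (ζ : ℂ) ≠ x)
    (hint : Integrable (fun ζ : Metric.sphere (0 : ℂ) 1 => 1 / ‖(ζ : ℂ) - x‖ ^ 2) μ)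
    {z : ℂ} (hz : ‖z‖ < 1) :
    herglotzIntegral μ z = herglotzIntegral μ x + 2 * (z - x) *
      ∫ ζ : Metric.sphere (0 : ℂ) 1, (ζ : ℂ) / (((ζ : ℂ) - z) * (ζ - x)) ∂μ := by
  have hinv : Integrable (fun ζ : Metric.sphere (0 : ℂ) 1 => ((ζ : ℂ) - x)⁻¹) μ := by
    refine ((integrable_const (1 : ℝ)).add hint).mono'
      (Measurable.aestronglyMeasurable (by fun_prop)) (Eventually.of_forall fun ζ => ?_)
    rw [norm_inv, Pi.add_apply, one_div, ← inv_pow]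
    nlinarith [sq_nonneg (‖(ζ : ℂ) - x‖⁻¹ - 1), sq_nonneg (‖(ζ : ℂ) - x‖⁻¹)]
  have hmul : ∀ g : Metric.sphere (0 : ℂ) 1 → ℂ, Continuous g →
      Integrable (fun ζ => g ζ * ((ζ : ℂ) - x)⁻¹) μ := by
    intro g hg
    obtain ⟨C, hC⟩ := isCompact_univ.exists_bound_of_continuousOn hg.continuousOn
    exact hinv.bdd_mul hg.aestronglyMeasurable (Eventually.of_forall fun ζ => hC ζ trivial)
  have hden : ∀ ζ : Metric.sphere (0 : ℂ) 1, (ζ : ℂ) - z ≠ 0 :=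
    fun ζ => unitSphere_sub_ne_zero ζ hz
  have i1 := hmul (fun ζ => (ζ : ℂ) + x) (by fun_prop)
  have i2 := (hmul (fun ζ => (ζ : ℂ) / (ζ - z))
    (continuous_subtype_val.div (by fun_prop) hden)).const_mul (2 * (z - x))
  rw [herglotzIntegral, herglotzIntegral, ← integral_const_mul, ← integral_add]
  · refine integral_congr_ae ?_
    filter_upwards [hne] with ζ hζ
    have h1 := hden ζ
    have h2 : (ζ : ℂ) - x ≠ 0 := sub_ne_zero.2 hζ
    field_simp
    ring
  · simpa only [div_eq_mul_inv] using i1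
  · refine i2.congr (Eventually.of_forall fun ζ => ?_)
    simp only [div_eq_mul_inv, mul_inv]
    ring

/-- If the Herglotz transform is `O(1 - r)` along a radius, then its difference quotient has a
non-tangential limit at the end point. -/
theorem herglotzIntegral_tendsto_of_radial_bound (μ : Measure (Metric.sphere (0 : ℂ) 1))
    [IsFiniteMeasure μ] {θ : ℝ} {x : ℂ} (hx : x = Complex.exp (θ * Complex.I)) {K : ℝ}
    (hK : ∀ᶠ r : ℝ in 𝓝[<] 1, ‖herglotzIntegral μ (r * x)‖ ≤ K * (1 - r)) :
    (∀ᵐ ζ : Metric.sphere (0 : ℂ) 1 ∂μ, (ζ : ℂ) ≠ x) ∧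
    Integrable (fun ζ : Metric.sphere (0 : ℂ) 1 => 1 / ‖(ζ : ℂ) - x‖ ^ 2) μ ∧
    Tendsto (fun z : ℂ => herglotzIntegral μ z / (x - z)) (angularFilter x)
      (𝓝 (2 * conj x * ((∫ ζ : Metric.sphere (0 : ℂ) 1, 1 / ‖(ζ : ℂ) - x‖ ^ 2 ∂μ : ℝ) : ℂ))) := by
  have hx1 : ‖x‖ = 1 := by rw [hx, Complex.norm_exp_ofReal_mul_I]
  have hbound : ∀ᶠ r : ℝ in 𝓝[<] 1,
      ∫ ζ : Metric.sphere (0 : ℂ) 1, 1 / ‖(ζ : ℂ) - r * x‖ ^ 2 ∂μ ≤ K := by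
    filter_upwards [hK, Ioo_zero_one_mem_nhdsLT_one] with r hrK hr
    have h := congrArg Complex.re (herglotzIntegral_radial_eq μ hx hr)
    rw [Complex.add_re, Complex.ofReal_re, Complex.re_ofReal_mul, Complex.I_re, mul_zero,
      add_zero] at h
    have h0 : 0 ≤ ∫ ζ : Metric.sphere (0 : ℂ) 1, 1 / ‖(ζ : ℂ) - r * x‖ ^ 2 ∂μ :=
      integral_nonneg fun ζ => by positivity
    have h1 : (herglotzIntegral μ (r * x) / ((1 - r : ℝ) : ℂ)).re ≤ K := by
      refine (Complex.re_le_norm _).trans ?_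
      have hpos : 0 < 1 - r := by linarith [hr.2]
      rw [norm_div, Complex.norm_real, Real.norm_of_nonneg hpos.le]
      exact (div_le_iff₀ hpos).2 hrK
    nlinarith [hr.1]
  obtain ⟨hne, hint⟩ := ae_ne_and_integrable_of_radial_bound μ hx1 hbound
  refine ⟨hne, hint, ?_⟩
  have hQ := tendsto_integral_differenceQuotient μ hx1 hne hint
  -- The boundary value is the radial limit of H, which the bound forces to be 0.
  have hzero : herglotzIntegral μ x = 0 := by
    have hr := tendsto_radial_angularFilter hx1
    have hcont : Tendsto (fun z : ℂ => 2 * (z - x)) (angularFilter x) (𝓝 0) := by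
      have hc : Continuous fun z : ℂ => 2 * (z - x) := by fun_prop
      simpa using (hc.tendsto x).mono_left (angularFilter_le_nhds x)
    have h1 := ((hcont.mul hQ).const_add (herglotzIntegral μ x)).comp hr
    rw [zero_mul, add_zero] at h1
    have h2 : Tendsto (fun r : ℝ => herglotzIntegral μ (r * x)) (𝓝[<] 1) (𝓝 0) := by
      refine squeeze_zero_norm' hK ?_
      have hc : Continuous fun r : ℝ => K * (1 - r) := by fun_prop
      simpa using (hc.tendsto 1).mono_left (nhdsWithin_le_nhds (s := Set.Iio 1))
    refine tendsto_nhds_unique h1 (h2.congr' ?_)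
    filter_upwards [Ioo_zero_one_mem_nhdsLT_one] with r hr
    exact herglotzIntegral_eq_add μ hne hint (by rw [norm_real_mul_unit hx1 hr]; exact hr.2)
  have hQ' := hQ.const_mul (-2)
  rw [show (-2 : ℂ) * (-conj x *
      ((∫ ζ : Metric.sphere (0 : ℂ) 1, 1 / ‖(ζ : ℂ) - x‖ ^ 2 ∂μ : ℝ) : ℂ)) = 2 * conj x *
      ((∫ ζ : Metric.sphere (0 : ℂ) 1, 1 / ‖(ζ : ℂ) - x‖ ^ 2 ∂μ : ℝ) : ℂ) by ring] at hQ'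
  refine hQ'.congr' ?_
  filter_upwards [eventually_norm_lt_one_angularFilter x] with z hz
  have hxz : x - z ≠ 0 := by
    intro h
    rw [← sub_eq_zero.1 h, hx1] at hz
    exact lt_irrefl _ hz
  rw [herglotzIntegral_eq_add μ hne hint hz, hzero]
  field_simp
  ring

/-! ### The two radial conditions and regular poles -/

theorem radial_integrals_tendsto_iff (μ : Measure (Metric.sphere (0 : ℂ) 1))
    [IsFiniteMeasure μ] {θ : ℝ} {x : ℂ} (hx : x = Complex.exp (θ * Complex.I)) :
    ((∃ L : ℝ, Tendsto (fun r : ℝ => ∫ ζ : Metric.sphere (0 : ℂ) 1,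
          1 / ‖(ζ : ℂ) - r * x‖ ^ 2 ∂μ) (𝓝[<] 1) (𝓝 L)) ∧
      Tendsto (fun r : ℝ => ∫ ζ : Metric.sphere (0 : ℂ) 1,
          Real.sin (Complex.arg (ζ : ℂ) - θ) / ‖(ζ : ℂ) - r * x‖ ^ 2 * (1 / (1 - r)) ∂μ)
        (𝓝[<] 1) (𝓝 0)) ↔
    ∃ K : ℝ, ∀ᶠ r : ℝ in 𝓝[<] 1, ‖herglotzIntegral μ (r * x)‖ ≤ K * (1 - r) := by
  have hx1 : ‖x‖ = 1 := by rw [hx, Complex.norm_exp_ofReal_mul_I]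
  have hid : Tendsto (fun r : ℝ => r) (𝓝[<] 1) (𝓝 1) := tendsto_id.mono_left nhdsWithin_le_nhds
  constructor
  · rintro ⟨⟨L, hL⟩, h0⟩
    have ha := (hid.const_add 1).mul hL
    have hb := ((hid.const_mul 2).neg).mul h0
    have hab := (((Complex.continuous_ofReal.tendsto _).comp ha).add
      (((Complex.continuous_ofReal.tendsto _).comp hb).mul_const Complex.I)).norm
    obtain ⟨K, hK⟩ := hab.isBoundedUnder_le
    refine ⟨K, ?_⟩
    filter_upwards [eventually_map.1 hK, Ioo_zero_one_mem_nhdsLT_one] with r hrK hr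
    have hpos : 0 < 1 - r := by linarith [hr.2]
    simp only [Function.comp_apply] at hrK
    rw [← herglotzIntegral_radial_eq μ hx hr, norm_div, Complex.norm_real,
      Real.norm_of_nonneg hpos.le, div_le_iff₀ hpos] at hrK
    exact hrK
  · rintro ⟨K, hK⟩
    obtain ⟨-, -, hlim⟩ := herglotzIntegral_tendsto_of_radial_bound μ hx hK
    set L := ∫ ζ : Metric.sphere (0 : ℂ) 1, 1 / ‖(ζ : ℂ) - x‖ ^ 2 ∂μ
    have hx0 : x ≠ 0 := by rintro rfl; simp at hx1
    have hq : Tendsto (fun r : ℝ => herglotzIntegral μ (r * x) / ((1 - r : ℝ) : ℂ)) (𝓝[<] 1)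
        (𝓝 ((2 * L : ℝ) : ℂ)) := by
      -- Multiplying by x cancels the phase x̄ and leaves a real limit.
      have h := (hlim.comp (tendsto_radial_angularFilter hx1)).const_mul x
      rw [show x * (2 * conj x * (L : ℂ)) = ((2 * L : ℝ) : ℂ) by
        rw [← Complex.inv_eq_conj hx1]; push_cast; field_simp] at h
      refine h.congr fun r => ?_
      simp only [Function.comp_apply]
      rw [show x - r * x = x * ((1 - r : ℝ) : ℂ) by push_cast; ring]
      field_simp
    have hre := (Complex.continuous_re.tendsto _).comp hq
    have him := (Complex.continuous_im.tendsto _).comp hq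
    rw [Complex.ofReal_re] at hre
    rw [Complex.ofReal_im] at him
    constructor
    · refine ⟨L, ?_⟩
      have h := hre.div (hid.const_add 1) (by norm_num)
      rw [show 2 * L / (1 + 1) = L by ring] at h
      refine h.congr' ?_
      filter_upwards [Ioo_zero_one_mem_nhdsLT_one] with r hr
      have : 1 + r ≠ 0 := by linarith [hr.1]
      simp only [Function.comp_apply, Pi.div_apply]
      rw [herglotzIntegral_radial_eq μ hx hr, Complex.add_re, Complex.ofReal_re,
        Complex.re_ofReal_mul, Complex.I_re, mul_zero, add_zero, mul_div_cancel_left₀ _ this]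
    · have h := him.div (hid.const_mul 2).neg (by norm_num)
      rw [zero_div] at h
      refine h.congr' ?_
      filter_upwards [Ioo_zero_one_mem_nhdsLT_one] with r hr
      have : -(2 * r) ≠ 0 := by linarith [hr.1]
      simp only [Function.comp_apply, Pi.div_apply]
      rw [herglotzIntegral_radial_eq μ hx hr, Complex.add_im, Complex.ofReal_im,
        Complex.im_ofReal_mul, Complex.I_im, mul_one, zero_add, mul_div_cancel_left₀ _ this]

theorem integral_one_div_norm_sub_sq_pos {μ : Measure (Metric.sphere (0 : ℂ) 1)} (hμ : μ ≠ 0)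
    {x : ℂ} (hne : ∀ᵐ ζ : Metric.sphere (0 : ℂ) 1 ∂μ, (ζ : ℂ) ≠ x)
    (hint : Integrable (fun ζ : Metric.sphere (0 : ℂ) 1 => 1 / ‖(ζ : ℂ) - x‖ ^ 2) μ) :
    0 < ∫ ζ : Metric.sphere (0 : ℂ) 1, 1 / ‖(ζ : ℂ) - x‖ ^ 2 ∂μ := by
  refine lt_of_le_of_ne (integral_nonneg fun ζ => by positivity) fun h => hμ ?_
  have h0 := (integral_eq_zero_iff_of_nonneg (fun ζ => by positivity) hint).1 h.symm
  rw [← ae_eq_bot, ← empty_mem_iff_bot]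
  filter_upwards [hne, h0] with ζ h1 h2
  have : ‖(ζ : ℂ) - x‖ ≠ 0 := norm_ne_zero_iff.2 (sub_ne_zero.2 h1)
  simp [this] at h2

/-- Away from its Denjoy--Wolff point, a boundary point is a regular pole of the generator exactly
when the Herglotz transform of its measure is `O(1 - r)` along the radius. -/
theorem mem_regularPoles_iff_radial_bound {τ : ℂ} (hτ : ‖τ‖ ≤ 1) {p G : ℂ → ℂ}
    (hp_ne : ∀ z ∈ Metric.ball (0 : ℂ) 1, p z ≠ 0)
    (hG : ∀ z ∈ Metric.ball (0 : ℂ) 1,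
      G z = (z - τ) * ((starRingEnd ℂ) τ * z - 1) * p z)
    (μ : Measure (Metric.sphere (0 : ℂ) 1)) [IsFiniteMeasure μ]
    (hμ : ∀ z ∈ Metric.ball (0 : ℂ) 1,
      1 / p z = 1 / (2 * (Real.pi : ℂ)) * herglotzIntegral μ z)
    {θ : ℝ} {x : ℂ} (hx : x = Complex.exp (θ * Complex.I)) (hxτ : x ≠ τ) :
    x ∈ regularPoles G ↔
      ∃ K : ℝ, ∀ᶠ r : ℝ in 𝓝[<] 1, ‖herglotzIntegral μ (r * x)‖ ≤ K * (1 - r) := by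
  have hx1 : ‖x‖ = 1 := by rw [hx, Complex.norm_exp_ofReal_mul_I]
  have hπ : (2 * (Real.pi : ℂ)) ≠ 0 := by simp [Real.pi_ne_zero]
  have hF0 : ∀ z : ℂ, ‖z‖ < 1 → herglotzIntegral μ z ≠ 0 := by
    intro z hz h
    have := hμ z (by simpa using hz)
    rw [h, mul_zero] at this
    exact one_div_ne_zero (hp_ne z (by simpa using hz)) this
  have hp : ∀ z : ℂ, ‖z‖ < 1 → p z = 2 * Real.pi / herglotzIntegral μ z := by
    intro z hz
    rw [← one_div_one_div (p z), hμ z (by simpa using hz)]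
    have := hF0 z hz
    field_simp
  have hGn : ∀ z : ℂ, ‖z‖ < 1 → ‖G z * (x - z)‖ =
      ‖z - τ‖ * ‖conj τ * z - 1‖ * (2 * Real.pi) / ‖herglotzIntegral μ z‖ * ‖x - z‖ := by
    intro z hz
    rw [hG z (by simpa using hz), hp z hz]
    simp only [norm_mul, norm_div, Complex.norm_real, Real.norm_of_nonneg Real.pi_pos.le,
      Complex.norm_ofNat]
    ring
  constructor
  · rintro ⟨C, -, hC, hlim⟩
    have hev : ∀ᶠ z in angularFilter x, ENNReal.ofReal (C / 2) < ENNReal.ofReal ‖G z * (x - z)‖ := by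
      refine eventually_lt_of_lt_liminf ?_
      rw [hlim]
      exact (ENNReal.ofReal_lt_ofReal_iff hC).2 (by linarith)
    -- Here C/2 < 2·2·2π(1 - r)/|H(rx)|, each factor vanishing at τ or at 1/τ̄ being at most 2.
    refine ⟨16 * Real.pi / C, ?_⟩
    filter_upwards [(tendsto_radial_angularFilter hx1).eventually hev,
      Ioo_zero_one_mem_nhdsLT_one] with r hrC hr
    have hz : ‖(r : ℂ) * x‖ < 1 := by rw [norm_real_mul_unit hx1 hr]; exact hr.2
    have h1 := (ENNReal.ofReal_lt_ofReal_iff_of_nonneg (by positivity)).1 hrC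
    rw [hGn _ hz, norm_sub_real_mul_unit hx1 hr] at h1
    have hFpos : 0 < ‖herglotzIntegral μ (r * x)‖ := norm_pos_iff.2 (hF0 _ hz)
    have h2 : ‖(r : ℂ) * x - τ‖ ≤ 2 := (norm_sub_le _ _).trans (by linarith)
    have h3 : ‖conj τ * (r * x) - 1‖ ≤ 2 := by
      refine (norm_sub_le _ _).trans ?_
      rw [norm_mul, RCLike.norm_conj, norm_one]
      nlinarith [norm_nonneg τ, norm_nonneg ((r : ℂ) * x)]
    have hpos : 0 < 1 - r := by linarith [hr.2]
    have h4 : ‖(r : ℂ) * x - τ‖ * ‖conj τ * (r * x) - 1‖ ≤ 2 * 2 :=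
      mul_le_mul h2 h3 (norm_nonneg _) (by norm_num)
    rw [div_mul_eq_mul_div, lt_div_iff₀ hFpos] at h1
    rw [div_mul_eq_mul_div, le_div_iff₀ hC]
    have h5 := mul_le_mul_of_nonneg_right h4 (mul_pos Real.two_pi_pos hpos).le
    nlinarith
  · rintro ⟨K, hK⟩
    obtain ⟨hne, hint, hlim⟩ := herglotzIntegral_tendsto_of_radial_bound μ hx hK
    -- The zero measure would give 1/p(0) = 0.
    have hμ0 : μ ≠ 0 := by
      rintro rfl
      exact hF0 0 (by simp) (by simp [herglotzIntegral])
    have hL := integral_one_div_norm_sub_sq_pos hμ0 hne hint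
    set L := ∫ ζ : Metric.sphere (0 : ℂ) 1, 1 / ‖(ζ : ℂ) - x‖ ^ 2 ∂μ
    -- As |x| = 1, a zero here would force τ = x.
    have hτx : conj τ * x - 1 ≠ 0 := by
      intro h
      have h1 : conj τ * x = 1 := sub_eq_zero.1 h
      have h2 : τ * conj x = 1 := by simpa using congrArg conj h1
      rw [← Complex.inv_eq_conj hx1] at h2
      have hx0 : x ≠ 0 := by rintro rfl; simp at hx1
      exact hxτ (by field_simp at h2; exact h2.symm)
    have hlimn := hlim.norm
    rw [show ‖2 * conj x * (L : ℂ)‖ = 2 * L by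
      simp [hx1, abs_of_pos hL]] at hlimn
    refine ⟨‖x - τ‖ * ‖conj τ * x - 1‖ * (2 * Real.pi) / (2 * L), hx1, ?_, ?_⟩
    · have := norm_pos_iff.2 (sub_ne_zero.2 hxτ)
      have := norm_pos_iff.2 hτx
      have := Real.pi_pos
      positivity
    · have := angularFilter_neBot hx1
      apply Tendsto.liminf_eq
      refine ENNReal.tendsto_ofReal ?_
      have hc : Continuous fun z : ℂ => ‖z - τ‖ * ‖conj τ * z - 1‖ * (2 * Real.pi) := by fun_prop
      refine (((hc.tendsto x).mono_left (angularFilter_le_nhds x)).div hlimn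
        (by positivity)).congr' ?_
      filter_upwards [eventually_norm_lt_one_angularFilter x] with z hz
      simp only [Pi.div_apply]
      rw [hGn z hz, norm_div, div_div_eq_mul_div, div_mul_eq_mul_div]

theorem proposition6p1
    (τ : ℂ) (hτ : ‖τ‖ ≤ 1)
    (p : ℂ → ℂ) (hp : DifferentiableOn ℂ p (Metric.ball (0 : ℂ) 1))
    (hp_re : ∀ z ∈ Metric.ball (0 : ℂ) 1, 0 ≤ (p z).re)
    (hp_ne : ∀ z ∈ Metric.ball (0 : ℂ) 1, p z ≠ 0)
    (G : ℂ → ℂ)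
    (hG : ∀ z ∈ Metric.ball (0 : ℂ) 1,
      G z = (z - τ) * ((starRingEnd ℂ) τ * z - 1) * p z)
    (μ : Measure (Metric.sphere (0 : ℂ) 1)) [IsFiniteMeasure μ]
    (hμ : ∀ z ∈ Metric.ball (0 : ℂ) 1,
      1 / p z = 1 / (2 * (Real.pi : ℂ)) * ∫ ζ : Metric.sphere (0 : ℂ) 1, ((ζ : ℂ) + z) / ((ζ : ℂ) - z) ∂μ)
    (θ : ℝ) (x : ℂ) (hx : x = Complex.exp (θ * Complex.I)) (hxτ : x ≠ τ) :
    x ∈ regularPoles G ↔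
      (∃ L : ℝ, Tendsto (fun r : ℝ => ∫ ζ : Metric.sphere (0 : ℂ) 1, 1 / ‖(ζ : ℂ) - r * x‖ ^ 2 ∂μ)
        (𝓝[<] 1) (𝓝 L)) ∧
      Tendsto (fun r : ℝ => ∫ ζ : Metric.sphere (0 : ℂ) 1,
          Real.sin (Complex.arg (ζ : ℂ) - θ) / ‖(ζ : ℂ) - r * x‖ ^ 2 * (1 / (1 - r)) ∂μ)
        (𝓝[<] 1) (𝓝 0) := by
  rw [radial_integrals_tendsto_iff μ hx]
  exact mem_regularPoles_iff_radial_bound hτ hp_ne hG μ hμ hx hxτ
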